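/- Let $X$ be a nonempty compact metric space that is locally homogeneous, in the following sense: for every $x\in X$ and every neighbourhood $V$ of $x$ there is a neighbourhood $W\subseteq V$ of $x$ such that for every $y\in W$ there exists a homeomorphism $h:X\to X$ with $h(x)=y$ and $h(z)=z$ for all $z\notin V$. Let $T:X\to X$ be a minimal homeomorphism, where a homeomorphism is called minimal if each of its two-sided orbits $\{T^n x: n\in\mathbb{Z}\}$ is dense. Let $\ell\ge 1$ be an integer, and let $\Psi:X\to O(\mathbb{R}^\ell)$ and $\rho:X\to\mathbb{R}^\ell$ be continuous. Then the homeomorphism $$F:X\times\mathbb{R}^\ell\to X\times\mathbb{R}^\ell,\qquad F(x,v)=\big(T(x),\,\Psi(x)v+\rho(x)\big),$$ is not minimal, i.e. some two-sided orbit $\{F^n(x,v):n\in\mathbb{Z}\}$ is not dense in $X\times\mathbb{R}^\ell$. -/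

import Mathlib

open Topology

/-- The two-sided orbit of `x` under the homeomorphism `T`. -/
def twoSidedOrbit {X : Type*} [TopologicalSpace X] (T : X ≃ₜ X) (x : X) : Set X :=
  Set.range fun n : ℤ => (T ^ n) x

/-- A homeomorphism is (two-sided) minimal if every two-sided orbit is dense. -/
def IsMinimalHomeo {X : Type*} [TopologicalSpace X] (T : X ≃ₜ X) : Prop :=
  ∀ x : X, Dense (twoSidedOrbit T x)

/-- Local homogeneity: every point `x` can be moved to every sufficiently close point `y` by a
homeomorphism of the whole space supported in an arbitrarily small neighbourhood of `x`. -/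
def LocallyHomogeneous (X : Type*) [TopologicalSpace X] : Prop :=
  ∀ x : X, ∀ V ∈ 𝓝 x, ∃ W ∈ 𝓝 x, W ⊆ V ∧
    ∀ y ∈ W, ∃ h : X ≃ₜ X, h x = y ∧ ∀ z, z ∉ V → h z = z

/-- The affine Euclidean isometry `v ↦ A v + b` of `ℝ^ℓ`. -/
noncomputable def affineIsom {ℓ : ℕ} (A : Matrix.orthogonalGroup (Fin ℓ) ℝ)
    (b v : EuclideanSpace ℝ (Fin ℓ)) : EuclideanSpace ℝ (Fin ℓ) :=
  Matrix.toEuclideanLin (A : Matrix (Fin ℓ) (Fin ℓ) ℝ) v + b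

/-- The inverse isometry `w ↦ A⁻¹ (w - b)`. -/
noncomputable def affineIsomInv {ℓ : ℕ} (A : Matrix.orthogonalGroup (Fin ℓ) ℝ)
    (b w : EuclideanSpace ℝ (Fin ℓ)) : EuclideanSpace ℝ (Fin ℓ) :=
  Matrix.toEuclideanLin ((A⁻¹ : Matrix.orthogonalGroup (Fin ℓ) ℝ) : Matrix (Fin ℓ) (Fin ℓ) ℝ)
    (w - b)

theorem affineIsomInv_affineIsom {ℓ : ℕ} (A : Matrix.orthogonalGroup (Fin ℓ) ℝ)
    (b v : EuclideanSpace ℝ (Fin ℓ)) : affineIsomInv A b (affineIsom A b v) = v := by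
  have h : ((A⁻¹ : Matrix.orthogonalGroup (Fin ℓ) ℝ) : Matrix (Fin ℓ) (Fin ℓ) ℝ) *
      (A : Matrix (Fin ℓ) (Fin ℓ) ℝ) = 1 := congrArg Subtype.val (inv_mul_cancel A)
  unfold affineIsomInv affineIsom
  rw [add_sub_cancel_right]
  simp only [Matrix.toEuclideanLin, Matrix.toLpLin_apply, Matrix.mulVec_mulVec, h,
    Matrix.one_mulVec]

theorem affineIsom_affineIsomInv {ℓ : ℕ} (A : Matrix.orthogonalGroup (Fin ℓ) ℝ)
    (b w : EuclideanSpace ℝ (Fin ℓ)) : affineIsom A b (affineIsomInv A b w) = w := by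
  have h : (A : Matrix (Fin ℓ) (Fin ℓ) ℝ) *
      ((A⁻¹ : Matrix.orthogonalGroup (Fin ℓ) ℝ) : Matrix (Fin ℓ) (Fin ℓ) ℝ) = 1 :=
    congrArg Subtype.val (mul_inv_cancel A)
  unfold affineIsomInv affineIsom
  simp only [Matrix.toEuclideanLin, Matrix.toLpLin_apply, Matrix.mulVec_mulVec, h,
    Matrix.one_mulVec]
  exact sub_add_cancel w b

theorem continuous_toEuclideanLin_apply {ℓ : ℕ} {Z : Type*} [TopologicalSpace Z]
    {M : Z → Matrix (Fin ℓ) (Fin ℓ) ℝ} {u : Z → EuclideanSpace ℝ (Fin ℓ)}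
    (hM : Continuous M) (hu : Continuous u) :
    Continuous fun z => Matrix.toEuclideanLin (M z) (u z) := by
  simp only [Matrix.toEuclideanLin, Matrix.toLpLin_apply]
  exact (PiLp.continuous_toLp 2 _).comp
    (hM.matrix_mulVec ((PiLp.continuous_ofLp 2 _).comp hu))

theorem continuous_orthogonal_inv_coe {ℓ : ℕ} :
    Continuous fun A : Matrix.orthogonalGroup (Fin ℓ) ℝ =>
      ((A⁻¹ : Matrix.orthogonalGroup (Fin ℓ) ℝ) : Matrix (Fin ℓ) (Fin ℓ) ℝ) := by
  change Continuous fun A : Matrix.orthogonalGroup (Fin ℓ) ℝ =>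
    Matrix.conjTranspose (A : Matrix (Fin ℓ) (Fin ℓ) ℝ)
  exact continuous_subtype_val.matrix_conjTranspose

/-- The cylindrical vortex `(x, v) ↦ (T x, Ψ(x) v + ρ(x))` as a homeomorphism of `X × ℝ^ℓ`. -/
noncomputable def cylindricalVortex {X : Type*} [TopologicalSpace X] {ℓ : ℕ} (T : X ≃ₜ X)
    (Ψ : C(X, Matrix.orthogonalGroup (Fin ℓ) ℝ)) (ρ : C(X, EuclideanSpace ℝ (Fin ℓ))) :
    (X × EuclideanSpace ℝ (Fin ℓ)) ≃ₜ (X × EuclideanSpace ℝ (Fin ℓ)) where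
  toFun p := (T p.1, affineIsom (Ψ p.1) (ρ p.1) p.2)
  invFun q := (T.symm q.1, affineIsomInv (Ψ (T.symm q.1)) (ρ (T.symm q.1)) q.2)
  left_inv p := by
    simp only [Homeomorph.symm_apply_apply, affineIsomInv_affineIsom]
  right_inv q := by
    simp only [Homeomorph.apply_symm_apply, affineIsom_affineIsomInv]
  continuous_toFun := by
    refine (T.continuous.comp continuous_fst).prodMk ?_
    exact (continuous_toEuclideanLin_apply
      (continuous_subtype_val.comp (Ψ.continuous.comp continuous_fst)) continuous_snd).add
      (ρ.continuous.comp continuous_fst)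
  continuous_invFun := by
    have hT : Continuous fun q : X × EuclideanSpace ℝ (Fin ℓ) => T.symm q.1 :=
      T.symm.continuous.comp continuous_fst
    refine hT.prodMk ?_
    exact continuous_toEuclideanLin_apply
      (continuous_orthogonal_inv_coe.comp (Ψ.continuous.comp hT))
      (continuous_snd.sub (ρ.continuous.comp hT))

section FibrewiseIsometries

variable {X : Type*} [TopologicalSpace X] {ℓ : ℕ}

/-! Iterates of `F` preserve distances within fibres. If `F` were minimal, compactness would bring
every point of the closed unit tube into the open one within time `N`. Given `(x, v)`, take a unit
vector `u` opposite to `v`: when `(x, u)` enters the open tube, the preserved distance `‖v‖ + 1`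
forces the image of `v` to have norm above `‖v‖`. So the norm increases somewhere in every window of
radius `N` (`exists_bounded_norm_increase`). But a long excursion from the unit tube back to it
attains its largest norm farther than `N` from both ends, a contradiction. -/

theorem norm_toEuclideanLin_orthogonal (A : Matrix.orthogonalGroup (Fin ℓ) ℝ)
    (v : EuclideanSpace ℝ (Fin ℓ)) :
    ‖Matrix.toEuclideanLin (A : Matrix (Fin ℓ) (Fin ℓ) ℝ) v‖ = ‖v‖ := by
  have hA : (A : Matrix (Fin ℓ) (Fin ℓ) ℝ).transpose * (A : Matrix (Fin ℓ) (Fin ℓ) ℝ) = 1 :=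
    (Matrix.mem_orthogonalGroup_iff' _ _).1 A.2
  rw [← sq_eq_sq₀ (norm_nonneg _) (norm_nonneg _), EuclideanSpace.real_norm_sq_eq,
    EuclideanSpace.real_norm_sq_eq]
  have h : ((A : Matrix (Fin ℓ) (Fin ℓ) ℝ).mulVec v.ofLp) ⬝ᵥ
      ((A : Matrix (Fin ℓ) (Fin ℓ) ℝ).mulVec v.ofLp) = v.ofLp ⬝ᵥ v.ofLp := by
    rw [Matrix.dotProduct_mulVec, ← Matrix.mulVec_transpose, Matrix.mulVec_mulVec, hA,
      Matrix.one_mulVec]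
  simpa only [dotProduct, ← sq, Matrix.toEuclideanLin, Matrix.toLpLin_apply] using h

theorem dist_affineIsom (A : Matrix.orthogonalGroup (Fin ℓ) ℝ)
    (b v w : EuclideanSpace ℝ (Fin ℓ)) :
    dist (affineIsom A b v) (affineIsom A b w) = dist v w := by
  rw [affineIsom, affineIsom, dist_add_right, dist_eq_norm, dist_eq_norm, ← map_sub,
    norm_toEuclideanLin_orthogonal]

/-- The iterates of a cylindrical vortex send fibres isometrically onto fibres. -/
theorem cylindricalVortex_zpow_fibre (T : X ≃ₜ X)
    (Ψ : C(X, Matrix.orthogonalGroup (Fin ℓ) ℝ)) (ρ : C(X, EuclideanSpace ℝ (Fin ℓ)))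
    (n : ℤ) {p q : X × EuclideanSpace ℝ (Fin ℓ)} (h : p.1 = q.1) :
    ((cylindricalVortex T Ψ ρ ^ n) p).1 = ((cylindricalVortex T Ψ ρ ^ n) q).1 ∧
      dist ((cylindricalVortex T Ψ ρ ^ n) p).2 ((cylindricalVortex T Ψ ρ ^ n) q).2 =
        dist p.2 q.2 := by
  have step : ∀ r s : X × EuclideanSpace ℝ (Fin ℓ), r.1 = s.1 →
      (cylindricalVortex T Ψ ρ r).1 = (cylindricalVortex T Ψ ρ s).1 ∧
        dist (cylindricalVortex T Ψ ρ r).2 (cylindricalVortex T Ψ ρ s).2 = dist r.2 s.2 := by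
    rintro ⟨x, v⟩ ⟨y, w⟩ (rfl : x = y)
    exact ⟨rfl, dist_affineIsom _ _ _ _⟩
  induction n with
  | zero => exact ⟨h, rfl⟩
  | succ k ih =>
    rw [add_comm, zpow_one_add]
    obtain ⟨h₁, h₂⟩ := step _ _ ih.1
    exact ⟨h₁, h₂.trans ih.2⟩
  | pred k ih =>
    rw [sub_eq_neg_add, zpow_add, zpow_neg_one]
    have e : ∀ r, cylindricalVortex T Ψ ρ ((cylindricalVortex T Ψ ρ)⁻¹ r) = r :=
      (cylindricalVortex T Ψ ρ).apply_symm_apply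
    set r := (cylindricalVortex T Ψ ρ ^ (-(k : ℤ))) p
    set s := (cylindricalVortex T Ψ ρ ^ (-(k : ℤ))) q
    have hfst : ((cylindricalVortex T Ψ ρ)⁻¹ r).1 = ((cylindricalVortex T Ψ ρ)⁻¹ s).1 :=
      congrArg T.symm ih.1
    -- The forward step is applied at the preimages, so no computation with the inverse is needed.
    have hd := (step _ _ hfst).2
    rw [e, e] at hd
    exact ⟨hfst, hd.symm.trans ih.2⟩

end FibrewiseIsometries

section MinimalHomeomorphisms

variable {Y : Type*} [TopologicalSpace Y]

/-- Under a minimal homeomorphism the points of a compact set visit a given nonempty open set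
within a bounded time. -/
theorem IsMinimalHomeo.exists_bounded_visit {F : Y ≃ₜ Y} (hF : IsMinimalHomeo F) {K U : Set Y}
    (hK : IsCompact K) (hU : IsOpen U) (hne : U.Nonempty) :
    ∃ N : ℕ, ∀ p ∈ K, ∃ n : ℤ, |n| ≤ N ∧ (F ^ n) p ∈ U := by
  obtain ⟨s, hs⟩ := hK.elim_finite_subcover (fun n : ℤ => (F ^ n) ⁻¹' U)
    (fun n => hU.preimage (F ^ n).continuous) (fun p _ => by
      obtain ⟨_, hq, n, rfl⟩ := (hF p).inter_open_nonempty U hU hne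
      exact Set.mem_iUnion.2 ⟨n, hq⟩)
  refine ⟨s.sup Int.natAbs, fun p hp => ?_⟩
  obtain ⟨n, hn, hpn⟩ := Set.mem_iUnion₂.1 (hs hp)
  refine ⟨n, ?_, hpn⟩
  rw [Int.abs_eq_natAbs]
  exact_mod_cast Finset.le_sup (f := Int.natAbs) hn

/-- Without isolated points, a dense orbit stays dense after finitely many points are removed. This
supplies visits arbitrarily far apart in time. -/
theorem IsMinimalHomeo.infinite_visits [T1Space Y] [∀ p : Y, (𝓝[≠] p).NeBot] {F : Y ≃ₜ Y}
    (hF : IsMinimalHomeo F) {U : Set Y} (hU : IsOpen U) (hne : U.Nonempty) (p : Y) :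
    {n : ℤ | (F ^ n) p ∈ U}.Infinite := by
  intro hfin
  obtain ⟨_, hq, ⟨n, rfl⟩, hn⟩ := ((hF p).sdiff_finite
    (hfin.image fun n : ℤ => (F ^ n) p)).inter_open_nonempty U hU hne
  exact hn ⟨n, hq, rfl⟩

end MinimalHomeomorphisms

section Excursions

variable {X : Type*} [TopologicalSpace X] {ℓ : ℕ}

/-- Along the orbits of a minimal cylindrical vortex the norm of the fibre coordinate has no local
maximum on a sufficiently long window. -/
theorem exists_bounded_norm_increase [CompactSpace X] [Nonempty X] (hℓ : 1 ≤ ℓ) {T : X ≃ₜ X}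
    {Ψ : C(X, Matrix.orthogonalGroup (Fin ℓ) ℝ)} {ρ : C(X, EuclideanSpace ℝ (Fin ℓ))}
    (hF : IsMinimalHomeo (cylindricalVortex T Ψ ρ)) :
    ∃ N : ℕ, ∀ p, ∃ n : ℤ, |n| ≤ N ∧ ‖p.2‖ < ‖((cylindricalVortex T Ψ ρ ^ n) p).2‖ := by
  have : Nonempty (Fin ℓ) := ⟨⟨0, hℓ⟩⟩
  obtain ⟨N, hN⟩ := hF.exists_bounded_visit
    (K := Set.univ ×ˢ Metric.closedBall (0 : EuclideanSpace ℝ (Fin ℓ)) 1)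
    -- `u` will lie on the unit sphere, hence the closed ball in `K`; the open target ball makes the
    -- final inequality strict.
    (U := Set.univ ×ˢ Metric.ball (0 : EuclideanSpace ℝ (Fin ℓ)) 1)
    (isCompact_univ.prod (isCompact_closedBall _ _)) (isOpen_univ.prod Metric.isOpen_ball)
    (Set.univ_nonempty.prod ⟨0, Metric.mem_ball_self one_pos⟩)
  refine ⟨N, fun p => ?_⟩
  obtain ⟨u, hu, hd⟩ : ∃ u : EuclideanSpace ℝ (Fin ℓ), ‖u‖ = 1 ∧ dist p.2 u = ‖p.2‖ + 1 := by
    rcases eq_or_ne p.2 0 with h0 | h0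
    · obtain ⟨u, hu⟩ := exists_norm_eq (EuclideanSpace ℝ (Fin ℓ)) zero_le_one
      exact ⟨u, hu, by rw [h0, dist_zero_left, hu, norm_zero, zero_add]⟩
    · have hpos : 0 < ‖p.2‖ := norm_pos_iff.2 h0
      refine ⟨-(‖p.2‖⁻¹ • p.2), by rw [norm_neg]; exact norm_smul_inv_norm (𝕜 := ℝ) h0, ?_⟩
      have : p.2 - -(‖p.2‖⁻¹ • p.2) = (1 + ‖p.2‖⁻¹) • p.2 := by rw [add_smul, one_smul]; abel
      rw [dist_eq_norm, this, norm_smul, Real.norm_of_nonneg (by positivity)]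
      field_simp
  obtain ⟨n, hn, -, hball⟩ := hN (p.1, u) ⟨trivial, by simp [hu]⟩
  refine ⟨n, hn, ?_⟩
  have hiso := (cylindricalVortex_zpow_fibre T Ψ ρ n (p := p) (q := (p.1, u)) rfl).2
  rw [hd] at hiso
  have htri := dist_le_norm_add_norm ((cylindricalVortex T Ψ ρ ^ n) p).2
    ((cylindricalVortex T Ψ ρ ^ n) (p.1, u)).2
  rw [mem_ball_zero_iff] at hball
  linarith

theorem exists_norm_bound_of_abs_le [CompactSpace X] (F : (X × EuclideanSpace ℝ (Fin ℓ)) ≃ₜ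
    (X × EuclideanSpace ℝ (Fin ℓ))) (N : ℕ) :
    ∃ M : ℝ, ∀ p : X × EuclideanSpace ℝ (Fin ℓ), ‖p.2‖ ≤ 1 → ∀ n : ℤ, |n| ≤ N →
      ‖((F ^ n) p).2‖ ≤ M := by
  have hK : IsCompact (Set.univ ×ˢ Metric.closedBall 0 1 : Set (X × EuclideanSpace ℝ (Fin ℓ))) :=
    isCompact_univ.prod (isCompact_closedBall _ _)
  choose M hM using fun n : ℤ => hK.exists_bound_of_continuousOn
    (f := fun p => ((F ^ n) p).2) (continuous_snd.comp (F ^ n).continuous).continuousOn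
  obtain ⟨B, hB⟩ := ((Set.finite_Icc (-(N : ℤ)) N).image M).bddAbove
  exact ⟨B, fun p hp n hn => (hM n p ⟨trivial, mem_closedBall_zero_iff.2 hp⟩).trans
    (hB ⟨n, abs_le.1 hn, rfl⟩)⟩

end Excursions

theorem mainTheorem1 {X : Type*} [MetricSpace X] [CompactSpace X] [Nonempty X]
    (hX : LocallyHomogeneous X) (T : X ≃ₜ X) (hT : IsMinimalHomeo T)
    {ℓ : ℕ} (hℓ : 1 ≤ ℓ)
    (Ψ : C(X, Matrix.orthogonalGroup (Fin ℓ) ℝ)) (ρ : C(X, EuclideanSpace ℝ (Fin ℓ))) :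
    ¬ IsMinimalHomeo (cylindricalVortex T Ψ ρ) := by
  intro hF
  have : Nonempty (Fin ℓ) := ⟨⟨0, hℓ⟩⟩
  obtain ⟨N, hN⟩ := exists_bounded_norm_increase hℓ hF
  set F := cylindricalVortex T Ψ ρ
  obtain ⟨M, hM⟩ := exists_norm_bound_of_abs_le F N
  have add_apply : ∀ (m n : ℤ) p, (F ^ (m + n)) p = (F ^ m) ((F ^ n) p) := fun m n p => by
    rw [zpow_add]; rfl
  obtain ⟨x₀⟩ := ‹Nonempty X›
  -- within a bounded time the fibre coordinate has norm larger than `M`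
  obtain ⟨N', hN'⟩ : ∃ N' : ℕ, ∀ p, ∃ n : ℤ, |n| ≤ N' ∧ M < ‖((F ^ n) p).2‖ := by
    obtain ⟨N', hN'⟩ := hF.exists_bounded_visit
      (K := Set.univ ×ˢ Metric.closedBall (0 : EuclideanSpace ℝ (Fin ℓ)) M)
      (U := {p | M < ‖p.2‖}) (isCompact_univ.prod (isCompact_closedBall _ _))
      (isOpen_lt continuous_const continuous_snd.norm) (by
        obtain ⟨u, hu⟩ := NormedSpace.exists_lt_norm ℝ (EuclideanSpace ℝ (Fin ℓ)) M
        exact ⟨(x₀, u), hu⟩)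
    refine ⟨N', fun p => ?_⟩
    rcases le_or_gt ‖p.2‖ M with h | h
    · exact hN' p ⟨trivial, mem_closedBall_zero_iff.2 h⟩
    · exact ⟨0, by simp, h⟩
  -- an excursion starting and ending in the unit ball
  obtain ⟨p, L, hp, hpL, hL⟩ : ∃ (p : X × EuclideanSpace ℝ (Fin ℓ)) (L : ℤ),
      ‖p.2‖ ≤ 1 ∧ ‖((F ^ L) p).2‖ ≤ 1 ∧ 2 * (N' : ℤ) ≤ L := by
    -- `X` may have isolated points; the fibre direction alone suffices since `ℓ ≥ 1`.
    have hinst : ∀ q : X × EuclideanSpace ℝ (Fin ℓ), (𝓝[≠] q).NeBot := by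
      rintro ⟨y, v⟩
      have hv : (𝓝[≠] v).NeBot := inferInstance
      have hmap : Filter.Tendsto (fun w => (y, w)) (𝓝[≠] v) (𝓝[≠] (y, v)) :=
        tendsto_nhdsWithin_of_tendsto_nhds_of_eventually_within _
          ((Continuous.prodMk_right y).continuousAt.tendsto.mono_left nhdsWithin_le_nhds)
          (eventually_mem_nhdsWithin.mono fun w hw h => hw (congrArg Prod.snd h))
      exact hmap.neBot
    have hinf := hF.infinite_visits (U := {q | ‖q.2‖ < 1})
      (isOpen_lt continuous_snd.norm continuous_const) ⟨(x₀, 0), by simp⟩ (x₀, 0)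
    obtain ⟨a, ha⟩ := hinf.nonempty
    obtain ⟨b, hb, hab⟩ := hinf.exists_notMem_finite
      (Set.finite_Icc (a - 2 * (N' : ℤ)) (a + 2 * N'))
    rw [Set.mem_Icc, not_and_or] at hab
    rcases hab with hab | hab
    · exact ⟨(F ^ b) (x₀, 0), a - b, le_of_lt hb, by
        rw [← add_apply, sub_add_cancel]; exact le_of_lt ha, by omega⟩
    · exact ⟨(F ^ a) (x₀, 0), b - a, le_of_lt ha, by
        rw [← add_apply, sub_add_cancel]; exact le_of_lt hb, by omega⟩
  obtain ⟨b, hb, hmax⟩ := (Finset.Icc 0 L).exists_max_image (fun n => ‖((F ^ n) p).2‖)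
    ⟨0, Finset.mem_Icc.2 ⟨le_rfl, by omega⟩⟩
  have hbM : M < ‖((F ^ b) p).2‖ := by
    -- Starting at time `N'` places the two-sided window in `[0, 2N']`, inside `[0, L]`.
    obtain ⟨m, hm, hlt⟩ := hN' ((F ^ (N' : ℤ)) p)
    rw [← add_apply] at hlt
    rw [abs_le] at hm
    exact hlt.trans_le (hmax _ (Finset.mem_Icc.2 ⟨by omega, by omega⟩))
  rw [Finset.mem_Icc] at hb
  -- Within time `N` of either end the norm is at most `M`, so the window of radius `N` around `b`
  -- stays in `[0, L]`.
  have hleft : (N : ℤ) < b := by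
    by_contra! h
    exact (hM p hp b (abs_le.2 ⟨by omega, h⟩)).not_gt hbM
  have hright : b < L - N := by
    by_contra! h
    have := hM _ hpL (b - L) (abs_le.2 ⟨by omega, by omega⟩)
    rw [← add_apply, sub_add_cancel] at this
    exact this.not_gt hbM
  obtain ⟨m, hm, hlt⟩ := hN ((F ^ b) p)
  rw [← add_apply] at hlt
  rw [abs_le] at hm
  exact (hmax (m + b) (Finset.mem_Icc.2 ⟨by omega, by omega⟩)).not_gt hlt
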